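/- For every $0<p\le 1$ there is a constant $K_p>0$, depending only on $p$, such that the following holds for every metric space $(\mathcal N,\rho)$, every integer $d\ge 0$ and every real $\gamma\ge 1$. Suppose that $\mathcal N$ has Nagata dimension at most $d$ with constant $\gamma$, i.e. for every $s>0$ there is a family $\mathcal C$ of non-empty subsets of $\mathcal N$ which covers $\mathcal N$, such that $\operatorname{diam} C\le\gamma s$ for every $C\in\mathcal C$, and such that every $A\subseteq\mathcal N$ with $\operatorname{diam} A\le s$ meets at most $d+1$ members of $\mathcal C$. Then $$\mathfrak{ae}_p(\mathcal N)\le K_p\,\gamma\,(d+1)^{1/p-1}\log(d+2).$$ Moreover, for every metric space $\mathcal M\supseteq\mathcal N$, every $p$-Banach space $Z$ and every Lipschitz map $f:\mathcal N\to Z$ there is a Lipschitz extension $F:\mathcal M\to Z$ of $f$ with $\operatorname{Lip}F\le K_p\,\gamma\,(d+1)^{1/p-1}\log(d+2)\cdot\operatorname{Lip}f$. Here a $p$-Banach space is a real vector space $Z$ with a map $\lVert\cdot\rVert:Z\to[0,\infty)$ that is positive definite, absolutely homogeneous, satisfies $\lVert x+y\rVert^p\le\lVert x\rVert^p+\lVert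 y\rVert^p$, and makes $Z$ complete for the metric $\lVert x-y\rVert^p$. For a map $f$ from a metric space to $Z$, $\operatorname{Lip}f=\sup_{x\ne y}\lVert f(x)-f(y)\rVert/\rho(x,y)$. The $p$-trace $\mathfrak t_p(\mathcal N,\mathcal M)$ of $\mathcal N$ in a metric space $\mathcal M\supseteq\mathcal N$ is the infimum of all $C\in(0,\infty]$ such that every Lipschitz map $f$ from $\mathcal N$ to any $p$-Banach space has a Lipschitz extension $F$ to $\mathcal M$ with $\operatorname{Lip}F\le C\operatorname{Lip}f$, and $\mathfrak{ae}_p(\mathcal N)=\sup\{\mathfrak t_p(\mathcal N,\mathcal M):\mathcal M\supseteq\mathcal N\}$. -/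

import Mathlib

open scoped ENNReal

/-- A `p`-norm on a real vector space `Z`: a positive definite, absolutely homogeneous map
`Z → [0, ∞)` with `‖x + y‖ ^ p ≤ ‖x‖ ^ p + ‖y‖ ^ p`. -/
structure PNorm (p : ℝ) (Z : Type*) [AddCommGroup Z] [Module ℝ Z] where
  /-- the underlying map -/
  toFun : Z → ℝ
  nonneg : ∀ x, 0 ≤ toFun x
  pos_of_ne_zero : ∀ x, x ≠ 0 → 0 < toFun x
  smul : ∀ (a : ℝ) (x : Z), toFun (a • x) = |a| * toFun x
  add_rpow_le : ∀ x y, toFun (x + y) ^ p ≤ toFun x ^ p + toFun y ^ p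

namespace PNorm

theorem map_zero {p : ℝ} {Z : Type*} [AddCommGroup Z] [Module ℝ Z] (ν : PNorm p Z) :
    ν.toFun 0 = 0 := by
  simpa using ν.smul 0 0

theorem map_sub_comm {p : ℝ} {Z : Type*} [AddCommGroup Z] [Module ℝ Z] (ν : PNorm p Z)
    (x y : Z) : ν.toFun (x - y) = ν.toFun (y - x) := by
  simpa using ν.smul (-1) (y - x)

/-- The metric `d(x, y) = ‖x - y‖ ^ p` of a `p`-normed space. -/
@[reducible]
noncomputable def metricSpace {p : ℝ} (hp : 0 < p) {Z : Type*} [AddCommGroup Z] [Module ℝ Z]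
    (ν : PNorm p Z) : MetricSpace Z where
  dist x y := ν.toFun (x - y) ^ p
  dist_self x := by
    change ν.toFun (x - x) ^ p = 0
    rw [sub_self, ν.map_zero, Real.zero_rpow hp.ne']
  dist_comm x y := by
    change ν.toFun (x - y) ^ p = ν.toFun (y - x) ^ p
    rw [ν.map_sub_comm]
  dist_triangle x y z := by
    change ν.toFun (x - z) ^ p ≤ ν.toFun (x - y) ^ p + ν.toFun (y - z) ^ p
    have h := ν.add_rpow_le (x - y) (y - z)
    rwa [sub_add_sub_cancel] at h
  eq_of_dist_eq_zero {x y} h := by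
    change ν.toFun (x - y) ^ p = 0 at h
    by_contra hne
    exact (Real.rpow_pos_of_pos (ν.pos_of_ne_zero _ (sub_ne_zero.mpr hne)) p).ne' h

/-- `(Z, ν)` is a `p`-Banach space: `0 < p ≤ 1` and `Z` is complete for the metric
`d(x, y) = ‖x - y‖ ^ p`. -/
def IsBanach {p : ℝ} {Z : Type*} [AddCommGroup Z] [Module ℝ Z] (ν : PNorm p Z) : Prop :=
  ∃ hp : 0 < p, p ≤ 1 ∧ @CompleteSpace Z (ν.metricSpace hp).toUniformSpace

/-- The Lipschitz constant `sup_{x ≠ y} ‖f x - f y‖ / ρ(x, y) ∈ [0, ∞]` of a map from a metric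
space into a `p`-normed space (taken with respect to the `p`-norm itself, not its `p`-th power).
The map is Lipschitz iff this is finite. -/
noncomputable def lip {p : ℝ} {Z : Type*} [AddCommGroup Z] [Module ℝ Z] (ν : PNorm p Z)
    {X : Type*} [MetricSpace X] (f : X → Z) : ℝ≥0∞ :=
  ⨆ (x : X) (y : X) (_ : x ≠ y), ENNReal.ofReal (ν.toFun (f x - f y) / dist x y)

end PNorm

/-- `N` has Nagata dimension at most `d` with constant `γ` (used for `γ ≥ 1`). -/
def HasNagataDimLE (N : Type*) [MetricSpace N] (d : ℕ) (γ : ℝ) : Prop :=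
  ∀ s : ℝ, 0 < s → ∃ 𝒞 : Set (Set N),
    (∀ C ∈ 𝒞, C.Nonempty) ∧
    ⋃₀ 𝒞 = Set.univ ∧
    (∀ C ∈ 𝒞, Metric.ediam C ≤ ENNReal.ofReal (γ * s)) ∧
    ∀ A : Set N, Metric.ediam A ≤ ENNReal.ofReal s →
      {C | C ∈ 𝒞 ∧ (C ∩ A).Nonempty}.encard ≤ d + 1

universe u v w

/-- The `p`-trace of `N` in `M`, where `N` is regarded as a subspace of `M` through the isometric
embedding `ι`: the infimum of all `C ∈ (0, ∞]` such that every Lipschitz map `f` from `N` into any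
`p`-Banach space `Z` has a Lipschitz extension `F` to `M` with `Lip F ≤ C * Lip f`. -/
noncomputable def pTrace (p : ℝ) {N : Type u} [MetricSpace N] {M : Type v} [MetricSpace M]
    (ι : N → M) : ℝ≥0∞ :=
  sInf {C : ℝ≥0∞ | 0 < C ∧
    ∀ (Z : Type w) [AddCommGroup Z] [Module ℝ Z] (ν : PNorm p Z), ν.IsBanach →
      ∀ f : N → Z, ν.lip f < ∞ →
        ∃ F : M → Z, (∀ x, F (ι x) = f x) ∧ ν.lip F < ∞ ∧ ν.lip F ≤ C * ν.lip f}

/-- The absolute `p`-extendability constant of `N`: the supremum of the `p`-traces of `N` in `M`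
over all metric spaces `M` that contain `N` isometrically. -/
noncomputable def absExtendability (p : ℝ) (N : Type u) [MetricSpace N] : ℝ≥0∞ :=
  ⨆ (M : Type v) (_ : MetricSpace M) (ι : N → M) (_ : Isometry ι), pTrace.{u, v, w} p ι

/-! The extension is of Whitney type. Off the closure of `N` put `F x = ∑ φ i x • f (z i)`, where
the `φ i` form a partition of unity subordinate to Nagata covers at dyadic scales comparable to the
distance `r x` to `N`, and `z i` is a point of `N` within `O(γ r x)` of `x`. At most `2(d+1)` terms
are nonzero at a point, hence at most `4(d+1)` at a pair of points.

For nearby `x`, `y`, `F x - F y = ∑ (φ i x - φ i y) • (f (z i) - f a)` with `a` in `N` near `x`.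
Passing from the ℓ¹ size of the coefficients to the `p`-norm of the sum costs `(4(d+1)) ^ (1/p - 1)`
(`PNorm.map_sum_smul_le`). Normalizing the bumps directly would only bound the ℓ¹ variation by a
multiple of `(d+1) dist x y / r x`. Normalizing their powers of exponent about `log₂ (d+1)` replaces
`d+1` by a logarithm (`sum_abs_normalized_pow_sub_le`). Distant pairs are compared through a point
of `N`, and completeness of the target handles the rest of the closure of `N`. -/

/-! ### Sums in `p`-normed spaces and Lipschitz maps into them. -/

theorem PNorm.map_sum_rpow_le {p : ℝ} (hp : 0 < p) {Z : Type*} [AddCommGroup Z] [Module ℝ Z]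
    (ν : PNorm p Z) {I : Type*} (T : Finset I) (w : I → Z) :
    ν.toFun (∑ i ∈ T, w i) ^ p ≤ ∑ i ∈ T, ν.toFun (w i) ^ p := by
  classical
  induction T using Finset.induction_on with
  | empty => simp [ν.map_zero, Real.zero_rpow hp.ne']
  | insert a s ha ih =>
    rw [Finset.sum_insert ha, Finset.sum_insert ha]
    linarith [ν.add_rpow_le (w a) (∑ i ∈ s, w i)]

/-- `p`-subadditivity bounds the sum by the ℓᵖ size of the coefficients; the power mean inequality
with exponent `1/p ≥ 1` then trades ℓᵖ for ℓ¹ at the price `card ^ (1/p - 1)`. -/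
theorem PNorm.map_sum_smul_le {p : ℝ} (hp : 0 < p) (hp1 : p ≤ 1) {Z : Type*} [AddCommGroup Z]
    [Module ℝ Z] (ν : PNorm p Z) {I : Type*} (T : Finset I) (a : I → ℝ) (w : I → Z) {W : ℝ}
    (hW : 0 ≤ W) (hw : ∀ i ∈ T, a i ≠ 0 → ν.toFun (w i) ≤ W) :
    ν.toFun (∑ i ∈ T, a i • w i) ≤ (T.card : ℝ) ^ (1 / p - 1) * (∑ i ∈ T, |a i|) * W := by
  have h1 : ν.toFun (∑ i ∈ T, a i • w i) ^ p ≤ (∑ i ∈ T, |a i| ^ p) * W ^ p := by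
    refine (ν.map_sum_rpow_le hp T _).trans ?_
    rw [Finset.sum_mul]
    refine Finset.sum_le_sum fun i hi => ?_
    rw [ν.smul, ← Real.mul_rpow (abs_nonneg _) hW]
    refine Real.rpow_le_rpow (mul_nonneg (abs_nonneg _) (ν.nonneg _)) ?_ hp.le
    by_cases h0 : a i = 0
    · simp [h0]
    · exact mul_le_mul_of_nonneg_left (hw i hi h0) (abs_nonneg _)
  have h2 : (∑ i ∈ T, |a i| ^ p) ^ (1 / p) ≤ (T.card : ℝ) ^ (1 / p - 1) * ∑ i ∈ T, |a i| := by
    have h := Real.rpow_sum_le_const_mul_sum_rpow T (fun i => |a i| ^ p)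
      (p := 1 / p) ((one_le_div hp).2 hp1)
    have e : ∀ i, |(|a i| ^ p)| = |a i| ^ p := fun i =>
      abs_of_nonneg (Real.rpow_nonneg (abs_nonneg _) _)
    have e' : ∀ i, (|a i| ^ p) ^ (1 / p) = |a i| := fun i => by
      rw [← Real.rpow_mul (abs_nonneg _), mul_one_div_cancel hp.ne', Real.rpow_one]
    simpa only [e, e'] using h
  have h0 : 0 ≤ ∑ i ∈ T, |a i| ^ p :=
    Finset.sum_nonneg fun i _ => Real.rpow_nonneg (abs_nonneg _) _
  have h3 := Real.rpow_le_rpow (Real.rpow_nonneg (ν.nonneg _) p) h1 (one_div_pos.2 hp).le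
  rw [← Real.rpow_mul (ν.nonneg _), mul_one_div_cancel hp.ne', Real.rpow_one,
    Real.mul_rpow h0 (Real.rpow_nonneg hW _), ← Real.rpow_mul hW, mul_one_div_cancel hp.ne',
    Real.rpow_one] at h3
  exact h3.trans (mul_le_mul_of_nonneg_right h2 hW)

theorem PNorm.map_add_le {p : ℝ} (hp : 0 < p) (hp1 : p ≤ 1) {Z : Type*} [AddCommGroup Z]
    [Module ℝ Z] (ν : PNorm p Z) (x y : Z) :
    ν.toFun (x + y) ≤ 2 ^ (1 / p - 1) * (2 * max (ν.toFun x) (ν.toFun y)) := by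
  have h := ν.map_sum_smul_le hp hp1 Finset.univ (fun _ : Fin 2 => (1 : ℝ)) ![x, y]
    (W := max (ν.toFun x) (ν.toFun y)) (le_max_of_le_left (ν.nonneg _))
    (by intro i _ _; fin_cases i <;> simp)
  simpa [Fin.sum_univ_two, mul_assoc, one_add_one_eq_two] using h

theorem PNorm.map_sub_le_lip {p : ℝ} {Z : Type*} [AddCommGroup Z] [Module ℝ Z] (ν : PNorm p Z)
    {X : Type*} [MetricSpace X] {f : X → Z} (hf : ν.lip f < ∞) (x y : X) :
    ν.toFun (f x - f y) ≤ (ν.lip f).toReal * dist x y := by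
  rcases eq_or_ne x y with rfl | hxy
  · simp [ν.map_zero]
  · have h : ENNReal.ofReal (ν.toFun (f x - f y) / dist x y) ≤ ν.lip f :=
      le_iSup_of_le x (le_iSup_of_le y (le_iSup_of_le hxy le_rfl))
    have h' := (ENNReal.ofReal_le_iff_le_toReal hf.ne).1 h
    rwa [div_le_iff₀ (dist_pos.2 hxy)] at h'

theorem PNorm.lip_le_of_map_sub_le {p : ℝ} {Z : Type*} [AddCommGroup Z] [Module ℝ Z]
    (ν : PNorm p Z) {X : Type*} [MetricSpace X] {f : X → Z} {L : ℝ}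
    (h : ∀ x y, ν.toFun (f x - f y) ≤ L * dist x y) : ν.lip f ≤ ENNReal.ofReal L := by
  refine iSup_le fun x => iSup_le fun y => iSup_le fun hxy => ENNReal.ofReal_le_ofReal ?_
  rw [div_le_iff₀ (dist_pos.2 hxy)]
  exact h x y

/-- A Lipschitz map into a `p`-Banach space defined on a dense set extends to the whole space with
the same Lipschitz constant. -/
theorem PNorm.exists_extension_of_dense {p : ℝ} {Z : Type*} [AddCommGroup Z] [Module ℝ Z]
    (ν : PNorm p Z) (hν : ν.IsBanach) {M : Type*} [MetricSpace M] {D : Set M} (hD : Dense D)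
    {f : M → Z} {L : ℝ} (hL : 0 ≤ L)
    (hf : ∀ x ∈ D, ∀ y ∈ D, ν.toFun (f x - f y) ≤ L * dist x y) :
    ∃ F : M → Z, (∀ x ∈ D, F x = f x) ∧ ∀ x y, ν.toFun (F x - F y) ≤ L * dist x y := by
  obtain ⟨hp, -, hc⟩ := hν
  let _ : MetricSpace Z := ν.metricSpace hp
  have hdist : ∀ a b : Z, dist a b = ν.toFun (a - b) ^ p := fun _ _ => rfl
  have key : ∀ x y : D, dist (f x) (f y) ≤ (L * dist x y) ^ p := fun x y =>
    Real.rpow_le_rpow (ν.nonneg _) (hf x x.2 y y.2) hp.le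
  have hcont : Continuous fun t : ℝ => (L * t) ^ p :=
    (continuous_const.mul continuous_id).rpow_const fun _ => Or.inr hp.le
  -- For the metric `‖x - y‖ ^ p` the map is only Hölder of exponent `p`, which still suffices to
  -- extend it by uniform continuity.
  have huc : UniformContinuous fun x : D => f x := by
    rw [Metric.uniformContinuous_iff]
    intro ε hε
    have ht : Filter.Tendsto (fun t : ℝ => (L * t) ^ p) (nhds 0) (nhds 0) := by
      simpa [Real.zero_rpow hp.ne'] using hcont.tendsto 0
    obtain ⟨δ, hδ, h⟩ := Metric.tendsto_nhds_nhds.1 ht ε hε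
    refine ⟨δ, hδ, fun {a b} hab => (key a b).trans_lt ?_⟩
    have := h (x := dist a b) (by simpa using hab)
    rw [Real.dist_eq, sub_zero] at this
    exact (le_abs_self _).trans_lt this
  have hdi : IsDenseInducing ((↑) : D → M) := hD.isDenseInducing_val
  have hui : IsUniformInducing ((↑) : D → M) := isUniformInducing_val D
  set F : M → Z := hdi.extend fun x : D => f x
  have hFc : Continuous F := (uniformContinuous_uniformly_extend hui hD.denseRange_val huc).continuous
  have hFe : ∀ x : D, F x = f x := fun x => hdi.extend_eq huc.continuous x
  refine ⟨F, fun x hx => hFe ⟨x, hx⟩, fun x y => ?_⟩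
  have hcl : dist (F x) (F y) ≤ (L * dist x y) ^ p := by
    refine isClosed_property2 (e := ((↑) : D → M)) hD.denseRange_val
      (p := fun x y => dist (F x) (F y) ≤ (L * dist x y) ^ p) ?_ (fun a b => ?_) x y
    · exact isClosed_le ((hFc.comp continuous_fst).dist (hFc.comp continuous_snd))
        (hcont.comp continuous_dist)
    · rw [hFe, hFe]; exact key a b
  exact (Real.rpow_le_rpow_iff (ν.nonneg _) (mul_nonneg hL dist_nonneg) hp).1 hcl

/-! ### Normalized powers and the logarithmic factor. -/

/-- Entries above `δ/2` gain a factor `2/δ` from one more power. The others contribute at most `2^Q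
(δ/2)^Q = δ^Q` altogether, which the single entry `≥ δ` absorbs. -/
theorem sum_pow_le_of_card_le_two_pow {I : Type*} (T : Finset I) {Q : ℕ} (hQ : T.card ≤ 2 ^ Q)
    {v : I → ℝ} (hv : ∀ i, 0 ≤ v i) {δ : ℝ} (hδ : 0 < δ) (hm : ∃ i ∈ T, δ ≤ v i) :
    ∑ i ∈ T, v i ^ Q ≤ 3 / δ * ∑ i ∈ T, v i ^ (Q + 1) := by
  have h1 : ∀ i ∈ T, v i ^ Q ≤ 2 / δ * v i ^ (Q + 1) + (δ / 2) ^ Q := by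
    intro i _
    rcases le_total (δ / 2) (v i) with h | h
    · have : v i ^ Q ≤ 2 / δ * v i ^ (Q + 1) := by
        rw [pow_succ, div_mul_eq_mul_div, le_div_iff₀ hδ]
        nlinarith [pow_nonneg (hv i) Q]
      have := pow_nonneg (half_pos hδ).le Q
      linarith
    · have := pow_le_pow_left₀ (hv i) h Q
      have := mul_nonneg (div_pos two_pos hδ).le (pow_nonneg (hv i) (Q + 1))
      linarith
  obtain ⟨j, hj, hjδ⟩ := hm
  have h2 : δ ^ (Q + 1) ≤ ∑ i ∈ T, v i ^ (Q + 1) :=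
    (pow_le_pow_left₀ hδ.le hjδ _).trans
      (Finset.single_le_sum (f := fun i => v i ^ (Q + 1)) (fun i _ => pow_nonneg (hv i) _) hj)
  have h3 : (T.card : ℝ) * (δ / 2) ^ Q ≤ δ ^ Q := by
    have : (T.card : ℝ) ≤ 2 ^ Q := by exact_mod_cast hQ
    calc (T.card : ℝ) * (δ / 2) ^ Q ≤ 2 ^ Q * (δ / 2) ^ Q := by gcongr
      _ = δ ^ Q := by rw [← mul_pow]; congr 1; ring
  have h4 : δ ^ Q ≤ 1 / δ * ∑ i ∈ T, v i ^ (Q + 1) := by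
    rw [div_mul_eq_mul_div, le_div_iff₀ hδ, one_mul, ← pow_succ]; exact h2
  calc ∑ i ∈ T, v i ^ Q ≤ ∑ i ∈ T, (2 / δ * v i ^ (Q + 1) + (δ / 2) ^ Q) := Finset.sum_le_sum h1
    _ = 2 / δ * ∑ i ∈ T, v i ^ (Q + 1) + T.card * (δ / 2) ^ Q := by
      rw [Finset.sum_add_distrib, ← Finset.mul_sum, Finset.sum_const, nsmul_eq_mul]
    _ ≤ 2 / δ * ∑ i ∈ T, v i ^ (Q + 1) + 1 / δ * ∑ i ∈ T, v i ^ (Q + 1) := by linarith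
    _ = _ := by ring

/-- Differentiating a power costs `Q + 1` and leaves exponent `Q`; the preceding lemma restores
exponent `Q + 1` for `3/δ`. The number of entries thus enters only through its logarithm `Q`. -/
theorem sum_abs_normalized_pow_sub_le {I : Type*} (T : Finset I) {Q : ℕ} (hQ : T.card ≤ 2 ^ Q)
    {u v : I → ℝ} (hu : ∀ i, 0 ≤ u i) (hv : ∀ i, 0 ≤ v i) {δ ε : ℝ} (hδ : 0 < δ)
    (hmu : ∃ i ∈ T, δ ≤ u i) (hmv : ∃ i ∈ T, δ ≤ v i) (huv : ∀ i, |u i - v i| ≤ ε) :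
    ∑ i ∈ T, |u i ^ (Q + 1) / (∑ j ∈ T, u j ^ (Q + 1)) - v i ^ (Q + 1) / ∑ j ∈ T, v j ^ (Q + 1)|
      ≤ 12 * (Q + 1) * ε / δ := by
  wlog hUV : ∑ j ∈ T, v j ^ (Q + 1) ≤ ∑ j ∈ T, u j ^ (Q + 1) generalizing u v
  · have := this hv hu hmv hmu (fun i => by rw [abs_sub_comm]; exact huv i) (le_of_not_ge hUV)
    simpa only [abs_sub_comm] using this
  have hε : 0 ≤ ε := by obtain ⟨i, -⟩ := hmu; exact (abs_nonneg _).trans (huv i)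
  have hpos : 0 < ∑ j ∈ T, v j ^ (Q + 1) := by
    obtain ⟨j, hj, hjδ⟩ := hmv
    exact (pow_pos (hδ.trans_le hjδ) _).trans_le
      (Finset.single_le_sum (f := fun i => v i ^ (Q + 1)) (fun i _ => pow_nonneg (hv i) _) hj)
  have su := sum_pow_le_of_card_le_two_pow T hQ hu hδ hmu
  have sv := sum_pow_le_of_card_le_two_pow T hQ hv hδ hmv
  set U := ∑ j ∈ T, u j ^ (Q + 1)
  set V := ∑ j ∈ T, v j ^ (Q + 1)
  have hU : 0 < U := hpos.trans_le hUV
  set A := ∑ i ∈ T, |u i ^ (Q + 1) - v i ^ (Q + 1)|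
  have hA : A ≤ (Q + 1) * ε * (6 / δ * U) := by
    have h1 : A ≤ ∑ i ∈ T, (Q + 1) * ε * (u i ^ Q + v i ^ Q) := by
      refine Finset.sum_le_sum fun i _ => ?_
      have h := abs_pow_sub_pow_le (u i) (v i) (Q + 1)
      rw [abs_of_nonneg (hu i), abs_of_nonneg (hv i), Nat.add_sub_cancel] at h
      have hmax : max (u i) (v i) ^ Q ≤ u i ^ Q + v i ^ Q := by
        rcases le_total (u i) (v i) with h | h
        · rw [max_eq_right h]; linarith [pow_nonneg (hu i) Q]
        · rw [max_eq_left h]; linarith [pow_nonneg (hv i) Q]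
      refine h.trans ?_
      push_cast
      rw [mul_comm |u i - v i|]
      have := huv i
      have : 0 ≤ max (u i) (v i) := le_max_of_le_left (hu i)
      gcongr
    rw [← Finset.mul_sum, Finset.sum_add_distrib] at h1
    refine h1.trans ?_
    have : 3 / δ * V ≤ 3 / δ * U := by gcongr
    have : 6 / δ * U = 3 / δ * U + 3 / δ * U := by ring
    gcongr
    linarith
  have hVU : U - V ≤ A := by
    simp only [U, V, A]
    rw [← Finset.sum_sub_distrib]
    exact Finset.sum_le_sum fun i _ => le_abs_self _
  have h2 : ∀ i ∈ T, |u i ^ (Q + 1) / U - v i ^ (Q + 1) / V| ≤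
      |u i ^ (Q + 1) - v i ^ (Q + 1)| / U + v i ^ (Q + 1) * (1 / V - 1 / U) := by
    intro i _
    have e : u i ^ (Q + 1) / U - v i ^ (Q + 1) / V =
        (u i ^ (Q + 1) - v i ^ (Q + 1)) / U - v i ^ (Q + 1) * (1 / V - 1 / U) := by ring
    have hn : 0 ≤ v i ^ (Q + 1) * (1 / V - 1 / U) :=
      mul_nonneg (pow_nonneg (hv i) _) (sub_nonneg.2 (one_div_le_one_div_of_le hpos hUV))
    rw [e]
    refine (abs_sub _ _).trans ?_
    rw [abs_div, abs_of_pos hU, abs_of_nonneg hn]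
  refine (Finset.sum_le_sum h2).trans ?_
  rw [Finset.sum_add_distrib, ← Finset.sum_div, ← Finset.sum_mul]
  change A / U + V * (1 / V - 1 / U) ≤ _
  have e : A / U + V * (1 / V - 1 / U) = (A + (U - V)) / U := by field_simp
  rw [e, div_le_iff₀ hU]
  have : 12 * (Q + 1) * ε / δ * U = 2 * ((Q + 1) * ε * (6 / δ * U)) := by ring
  linarith

/-! ### Whitney bumps from Nagata covers. -/

/-- Positive on `(2 ^ (k - 1), 2 ^ (k + 1))` and zero elsewhere. -/
noncomputable def dyadicTent (k : ℤ) (t : ℝ) : ℝ :=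
  min (t - 2 ^ k / 2) (2 * 2 ^ k - t)

theorem exists_dyadicTent_ge {t : ℝ} (ht : 0 < t) : ∃ k : ℤ, t / 8 ≤ dyadicTent k t := by
  obtain ⟨k, hk1, hk2⟩ := exists_mem_Ico_zpow ht (one_lt_two : (1 : ℝ) < 2)
  rw [zpow_add₀ two_ne_zero, zpow_one] at hk2
  rcases le_total t (3 / 2 * 2 ^ k) with h | h
  · exact ⟨k, le_min (by linarith) (by linarith)⟩
  · refine ⟨k + 1, le_min ?_ ?_⟩ <;> rw [zpow_add₀ two_ne_zero, zpow_one] <;> linarith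

theorem exists_forall_dyadicTent_pos (t : ℝ) :
    ∃ l : ℤ, ∀ k : ℤ, 0 < dyadicTent k t → k = l ∨ k = l + 1 := by
  rcases le_or_gt t 0 with ht | ht
  · refine ⟨0, fun k hk => ?_⟩
    have h := (lt_min_iff.1 hk).1
    have : (0 : ℝ) < 2 ^ k := zpow_pos two_pos k
    linarith
  · obtain ⟨l, hl1, hl2⟩ := exists_mem_Ico_zpow ht (one_lt_two : (1 : ℝ) < 2)
    refine ⟨l, fun k hk => ?_⟩
    obtain ⟨h1, h2⟩ := lt_min_iff.1 hk
    have h3 : (2 : ℝ) ^ l < 2 ^ (k + 1) := by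
      rw [zpow_add₀ two_ne_zero, zpow_one]; linarith
    have h4 : (2 : ℝ) ^ k < 2 ^ (l + 2) := by
      rw [zpow_add₀ two_ne_zero, zpow_one] at hl2
      rw [zpow_add₀ two_ne_zero]; norm_num; linarith
    have h5 := (zpow_lt_zpow_iff_right₀ one_lt_two).1 h3
    have h6 := (zpow_lt_zpow_iff_right₀ one_lt_two).1 h4
    omega

/-- A Whitney-type family of bumps on a metric space containing a space of finite Nagata
dimension: the `i`-th bump is `1`-Lipschitz, lives off the subspace, and is attached to a point
`z i` of the subspace whose distance to the support is controlled. -/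
theorem HasNagataDimLE.exists_whitney_bumps {N : Type*} [MetricSpace N] [Nonempty N] {d : ℕ}
    {γ : ℝ} (hγ : 1 ≤ γ) (hN : HasNagataDimLE N d γ) {M : Type*} [MetricSpace M] {ι : N → M}
    (hι : Isometry ι) :
    ∃ (h : ℤ × Set N → M → ℝ) (z : ℤ × Set N → N) (T : M → Finset (ℤ × Set N)),
      (∀ i x, 0 ≤ h i x) ∧ (∀ i x y, |h i x - h i y| ≤ dist x y) ∧
      (∀ x i, i ∈ T x ↔ 0 < h i x) ∧ (∀ x, (T x).card ≤ 2 * (d + 1)) ∧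
      (∀ x, 0 < Metric.infDist x (Set.range ι) →
        ∃ i, Metric.infDist x (Set.range ι) / 8 ≤ h i x) ∧
      ∀ i x, 0 < h i x → dist x (ι (z i)) ≤ 24 * γ * Metric.infDist x (Set.range ι) := by
  classical
  have hpos : ∀ k : ℤ, (0 : ℝ) < 2 ^ k := fun k => zpow_pos two_pos k
  -- Points of `N` within `4 * 2 ^ k` of a common point are less than `8 * 2 ^ k` apart, so such a
  -- set meets at most `d + 1` members of the cover.
  choose 𝒞 hne hcov hdiam hmult using fun k : ℤ => hN (8 * 2 ^ k) (by have := hpos k; linarith)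
  have hz : ∀ i : ℤ × Set N, ∃ a : N, i.2.Nonempty → a ∈ i.2 := fun i => by
    by_cases h : i.2.Nonempty
    · exact ⟨h.some, fun _ => h.some_mem⟩
    · exact ⟨Classical.arbitrary N, fun h' => absurd h' h⟩
  choose z hz using hz
  set r : M → ℝ := fun x => Metric.infDist x (Set.range ι) with hr
  have hrange : (Set.range ι).Nonempty := Set.range_nonempty ι
  have hinf : ∀ (s : Set M) x y, |Metric.infDist x s - Metric.infDist y s| ≤ dist x y :=
    fun s x y => by
      have := (Metric.lipschitz_infDist_pt s).dist_le_mul x y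
      rwa [NNReal.coe_one, one_mul, Real.dist_eq] at this
  -- The tent selects the scale and the second term selects cover members near `x`. The radius `4 *
  -- 2 ^ k` is twice the largest `r x` in the tent's support, so for a member containing a nearly
  -- closest point the tent is the smaller term.
  set h : ℤ × Set N → M → ℝ := fun i x =>
    if i.2 ∈ 𝒞 i.1 then
      max 0 (min (dyadicTent i.1 (r x)) (4 * 2 ^ i.1 - Metric.infDist x (ι '' i.2))) else 0 with hh
  have hnear : ∀ i x, 0 < h i x → i.2 ∈ 𝒞 i.1 ∧ 0 < dyadicTent i.1 (r x) ∧
      ∃ c ∈ i.2, dist x (ι c) < 4 * 2 ^ i.1 := by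
    intro i x hi
    simp only [hh] at hi
    split_ifs at hi with hC
    · rcases lt_max_iff.1 hi with h0 | h0
      · exact absurd h0 (lt_irrefl _)
      · obtain ⟨h1, h2⟩ := lt_min_iff.1 h0
        obtain ⟨_, ⟨c, hc, rfl⟩, hd⟩ :=
          (Metric.infDist_lt_iff ((hne _ _ hC).image ι)).1 (sub_pos.1 h2)
        exact ⟨hC, h1, c, hc, hd⟩
    · exact absurd hi (lt_irrefl _)
  have hcount : ∀ x, {i | 0 < h i x}.encard ≤ (2 * (d + 1) : ℕ) := by
    intro x
    obtain ⟨l, hl⟩ := exists_forall_dyadicTent_pos (r x)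
    set S : ℤ → Set (Set N) := fun k =>
      {C | C ∈ 𝒞 k ∧ (C ∩ {a | dist x (ι a) < 4 * 2 ^ k}).Nonempty}
    have hS : ∀ k, (S k).encard ≤ d + 1 := fun k => by
      refine hmult k _ (Metric.ediam_le_of_forall_dist_le fun a ha b hb => ?_)
      have h1 : dist x (ι a) < 4 * 2 ^ k := ha
      have h2 : dist x (ι b) < 4 * 2 ^ k := hb
      rw [← hι.dist_eq]
      linarith [dist_triangle_left (ι a) (ι b) x]
    have hsub : {i | 0 < h i x} ⊆ Prod.mk l '' S l ∪ Prod.mk (l + 1) '' S (l + 1) := by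
      rintro ⟨k, C⟩ hi
      obtain ⟨hC, hk, c, hc, hd⟩ := hnear _ x hi
      have hmem : C ∈ S k := ⟨hC, c, hc, hd⟩
      rcases hl k hk with rfl | rfl
      · exact Or.inl ⟨C, hmem, rfl⟩
      · exact Or.inr ⟨C, hmem, rfl⟩
    calc _ ≤ _ := Set.encard_le_encard hsub
      _ ≤ _ := Set.encard_union_le _ _
      _ ≤ ((d : ℕ∞) + 1) + (d + 1) :=
        add_le_add ((Set.encard_image_le _ _).trans (hS _)) ((Set.encard_image_le _ _).trans (hS _))
      _ = _ := by push_cast; ring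
  have hfin : ∀ x, {i | 0 < h i x}.Finite := fun x =>
    Set.finite_of_encard_le_coe (hcount x)
  refine ⟨h, z, fun x => (hfin x).toFinset, ?_, ?_, ?_, ?_, ?_, ?_⟩
  · intro i x
    simp only [hh]
    split_ifs
    · exact le_max_left _ _
    · exact le_rfl
  · intro i x y
    simp only [hh]
    split_ifs
    · have h1 := hinf (Set.range ι) x y
      have h2 := hinf (ι '' i.2) x y
      refine (abs_max_sub_max_le_max _ _ _ _).trans (max_le (by simp) ?_)
      refine (abs_min_sub_min_le_max _ _ _ _).trans (max_le ?_ ?_)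
      · refine (abs_min_sub_min_le_max _ _ _ _).trans (max_le ?_ ?_)
        · rwa [sub_sub_sub_cancel_right]
        · rwa [sub_sub_sub_cancel_left, abs_sub_comm]
      · rwa [sub_sub_sub_cancel_left, abs_sub_comm]
    · simp
  · intro x i; simp
  · intro x
    have := hcount x
    rw [(hfin x).encard_eq_coe_toFinset_card] at this
    exact_mod_cast this
  · intro x hx
    obtain ⟨k, hk⟩ := exists_dyadicTent_ge hx
    have hk0 : 0 < dyadicTent k (r x) := (by positivity : 0 < r x / 8).trans_le hk
    have hlt : r x < 2 * 2 ^ k := by linarith [(lt_min_iff.1 hk0).2]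
    obtain ⟨_, ⟨a, rfl⟩, ha⟩ := (Metric.infDist_lt_iff hrange).1 hlt
    have ha' : a ∈ ⋃₀ 𝒞 k := by rw [hcov]; trivial
    obtain ⟨C, hC, haC⟩ := ha'
    refine ⟨(k, C), ?_⟩
    simp only [hh, if_pos hC]
    refine le_max_of_le_right (le_min hk ?_)
    have h1 : Metric.infDist x (ι '' C) ≤ dist x (ι a) :=
      Metric.infDist_le_dist_of_mem (Set.mem_image_of_mem ι haC)
    have h2 := hpos k
    have h3 : dyadicTent k (r x) ≤ 2 * 2 ^ k := (min_le_right _ _).trans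
      (by linarith [(Metric.infDist_nonneg : 0 ≤ r x)])
    change r x / 8 ≤ _
    linarith
  · intro i x hi
    obtain ⟨hC, hk, c, hc, hd⟩ := hnear i x hi
    have h1 := (lt_min_iff.1 hk).1
    have h2 := hpos i.1
    have h3 : dist c (z i) ≤ γ * (8 * 2 ^ i.1) := by
      have h := (Metric.edist_le_ediam_of_mem hc (hz i (hne _ _ hC))).trans (hdiam _ _ hC)
      rw [edist_dist] at h
      exact (ENNReal.ofReal_le_ofReal_iff (by positivity)).1 h
    have h4 := dist_triangle x (ι c) (ι (z i))
    rw [hι.dist_eq] at h4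
    -- `4 * 2 ^ k + 8 * γ * 2 ^ k ≤ 12 * γ * 2 ^ k`, and `2 ^ k < 2 * r x` on the support of the
    -- tent.
    change _ ≤ 24 * γ * r x
    nlinarith

/-! ### The Lipschitz extension off the closure. -/

theorem exists_two_pow_ge_mul_log (d : ℕ) :
    ∃ Q : ℕ, 4 * (d + 1) ≤ 2 ^ Q ∧ (Q : ℝ) + 1 ≤ 10 * Real.log ((d : ℝ) + 2) := by
  refine ⟨Nat.clog 2 (4 * (d + 1)), Nat.le_pow_clog one_lt_two _, ?_⟩
  obtain ⟨q, hq⟩ : ∃ q, Nat.clog 2 (4 * (d + 1)) = q + 1 :=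
    Nat.exists_eq_succ_of_ne_zero (Nat.clog_pos one_lt_two (by omega)).ne'
  have h1 : 2 ^ q < 4 * (d + 1) := (Nat.lt_clog_iff_pow_lt one_lt_two).1 (by omega)
  have h2 : (2 : ℝ) ^ q ≤ 2 ^ 2 * ((d : ℝ) + 2) := by
    have : (2 : ℝ) ^ q < 4 * (d + 1) := by exact_mod_cast h1
    linarith
  have h3 := Real.log_le_log (by positivity) h2
  rw [Real.log_mul (by positivity) (by positivity), Real.log_pow, Real.log_pow] at h3
  have h4 : Real.log 2 ≤ Real.log ((d : ℝ) + 2) :=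
    Real.log_le_log two_pos (by linarith [(Nat.cast_nonneg d : (0 : ℝ) ≤ d)])
  have h5 := Real.log_two_gt_d9
  rw [hq]
  push_cast at h3 ⊢
  have h6 : (q : ℝ) * (1 / 2) ≤ q * Real.log 2 := by gcongr; linarith
  nlinarith

theorem PNorm.map_normalized_sum_sub_le {p : ℝ} (hp : 0 < p) (hp1 : p ≤ 1) {Z : Type*}
    [AddCommGroup Z] [Module ℝ Z] (ν : PNorm p Z) {I : Type*} (T : Finset I) {n : ℝ}
    (hT : T.card ≤ n) {a : I → ℝ} (ha : ∀ i ∈ T, 0 ≤ a i) (ha1 : ∑ i ∈ T, a i = 1) (w : I → Z)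
    (c : Z) {W : ℝ} (hW : 0 ≤ W) (hw : ∀ i ∈ T, ν.toFun (w i - c) ≤ W) :
    ν.toFun ((∑ i ∈ T, a i • w i) - c) ≤ n ^ (1 / p - 1) * W := by
  have e : (∑ i ∈ T, a i • w i) - c = ∑ i ∈ T, a i • (w i - c) := by
    simp only [smul_sub, Finset.sum_sub_distrib, ← Finset.sum_smul, ha1, one_smul]
  have h := ν.map_sum_smul_le hp hp1 T a (fun i => w i - c) hW fun i hi _ => hw i hi
  rw [Finset.sum_congr rfl fun i hi => abs_of_nonneg (ha i hi), ha1, mul_one] at h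
  rw [e]
  refine h.trans (mul_le_mul_of_nonneg_right ?_ hW)
  exact Real.rpow_le_rpow (Nat.cast_nonneg _) hT (sub_nonneg.2 ((one_le_div hp).2 hp1))

/-- A Lipschitz map into a `p`-normed space defined on a subspace of finite Nagata dimension
extends to the union of the subspace and the complement of its closure. -/
theorem HasNagataDimLE.exists_lipschitz_off_closure {p : ℝ} (hp : 0 < p) (hp1 : p ≤ 1)
    {N : Type*} [MetricSpace N] [Nonempty N] {d : ℕ} {γ : ℝ} (hγ : 1 ≤ γ)
    (hN : HasNagataDimLE N d γ) {M : Type*} [MetricSpace M] {ι : N → M} (hι : Isometry ι)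
    {Z : Type*} [AddCommGroup Z] [Module ℝ Z] (ν : PNorm p Z) {f : N → Z} {L : ℝ} (hL : 0 ≤ L)
    (hf : ∀ a b, ν.toFun (f a - f b) ≤ L * dist a b) :
    ∃ F : M → Z, (∀ a, F (ι a) = f a) ∧
      ∀ x ∈ Set.range ι ∪ {x | 0 < Metric.infDist x (Set.range ι)},
      ∀ y ∈ Set.range ι ∪ {x | 0 < Metric.infDist x (Set.range ι)},
        ν.toFun (F x - F y) ≤ 100000 * (4 ^ (1 / p - 1)) ^ 2 *
          (γ * ((d : ℝ) + 1) ^ (1 / p - 1) * Real.log ((d : ℝ) + 2)) * L * dist x y := by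
  classical
  obtain ⟨h, z, T, h0, hlip, hT, hcard, hbig, hz⟩ := hN.exists_whitney_bumps hγ hι
  obtain ⟨Q, hQ, hQlog⟩ := exists_two_pow_ge_mul_log d
  set r : M → ℝ := fun x => Metric.infDist x (Set.range ι) with hr
  set B : ℝ := 4 ^ (1 / p - 1)
  set E : ℝ := ((d : ℝ) + 1) ^ (1 / p - 1)
  set G : ℝ := Real.log ((d : ℝ) + 2)
  have hexp : 0 ≤ 1 / p - 1 := sub_nonneg.2 ((one_le_div hp).2 hp1)
  have hB : 1 ≤ B := Real.one_le_rpow (by norm_num) hexp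
  have hE : 1 ≤ E := Real.one_le_rpow (by linarith [(Nat.cast_nonneg d : (0 : ℝ) ≤ d)]) hexp
  have hG : 1 / 2 ≤ G := by
    have h4 : Real.log 2 ≤ G :=
      Real.log_le_log two_pos (by linarith [(Nat.cast_nonneg d : (0 : ℝ) ≤ d)])
    linarith [Real.log_two_gt_d9]
  have hBE : (4 * ((d : ℝ) + 1)) ^ (1 / p - 1) = B * E :=
    Real.mul_rpow (by norm_num) (by positivity)
  have hBEpos : 0 < B * E := by positivity
  set φ : M → ℤ × Set N → ℝ := fun x i => h i x ^ (Q + 1) / ∑ j ∈ T x, h j x ^ (Q + 1) with hφ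
  set S : M → Z := fun x => ∑ i ∈ T x, φ x i • f (z i) with hS
  have hφ0 : ∀ x i, 0 ≤ φ x i := fun x i =>
    div_nonneg (pow_nonneg (h0 _ _) _) (Finset.sum_nonneg fun j _ => pow_nonneg (h0 _ _) _)
  have hzero : ∀ x i, i ∉ T x → h i x = 0 := fun x i hi =>
    le_antisymm (not_lt.1 fun hlt => hi ((hT x i).2 hlt)) (h0 i x)
  have hφzero : ∀ x i, i ∉ T x → φ x i = 0 := fun x i hi => by
    simp only [hφ]; rw [hzero x i hi]; simp
  have hφ1 : ∀ x, 0 < r x → ∑ i ∈ T x, φ x i = 1 := fun x hx => by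
    obtain ⟨j, hj⟩ := hbig x hx
    have hj0 : 0 < h j x := (by positivity : 0 < r x / 8).trans_le hj
    have hpos : 0 < ∑ j ∈ T x, h j x ^ (Q + 1) := (pow_pos hj0 (Q + 1)).trans_le
      (Finset.single_le_sum (f := fun i => h i x ^ (Q + 1)) (fun i _ => pow_nonneg (h0 i x) _)
        ((hT x j).2 hj0))
    simp only [hφ]
    rw [← Finset.sum_div, div_self hpos.ne']
  have hr_le : ∀ x a, r x ≤ dist x (ι a) := fun x a =>
    Metric.infDist_le_dist_of_mem (Set.mem_range_self a)
  have hr0 : ∀ x, 0 ≤ r x := fun x => Metric.infDist_nonneg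
  have hza : ∀ x a i, i ∈ T x → dist (z i) a ≤ 24 * γ * r x + dist x (ι a) := fun x a i hi => by
    rw [← hι.dist_eq]
    have := dist_triangle_left (ι (z i)) (ι a) x
    linarith [hz i x ((hT x i).1 hi)]
  have hpoint : ∀ x, 0 < r x → ∀ a,
      ν.toFun (S x - f a) ≤ B * E * (25 * γ * L * dist x (ι a)) := by
    intro x hx a
    rw [← hBE]
    refine ν.map_normalized_sum_sub_le hp hp1 (T x) ?_ (fun i _ => hφ0 x i) (hφ1 x hx) _ _
      (by positivity) fun i hi => ?_
    · have : ((T x).card : ℝ) ≤ (2 * (d + 1) : ℕ) := by exact_mod_cast hcard x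
      push_cast at this
      linarith [(Nat.cast_nonneg d : (0 : ℝ) ≤ d)]
    · refine (hf _ _).trans ?_
      have h1 := hza x a i hi
      have h2 : dist (z i) a ≤ 25 * γ * dist x (ι a) := by
        have h3 : 24 * γ * r x ≤ 24 * γ * dist x (ι a) := by gcongr; exact hr_le x a
        have h4 : 1 * dist x (ι a) ≤ γ * dist x (ι a) := by gcongr
        linarith
      calc L * dist (z i) a ≤ L * (25 * γ * dist x (ι a)) := by gcongr
        _ = _ := by ring
  have hclose : ∀ x, 0 < r x → ∃ a, dist x (ι a) < 2 * r x := fun x hx => by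
    obtain ⟨_, ⟨a, rfl⟩, ha⟩ := (Metric.infDist_lt_iff (Set.range_nonempty ι)).1
      (show Metric.infDist x (Set.range ι) < 2 * r x by simp only [hr] at hx ⊢; linarith)
    exact ⟨a, ha⟩
  -- Since `G ≥ 1 / 2`, numerical constants up to `50000` fit under `100000 * G`.
  have hcst : ∀ t : ℝ, 0 ≤ t → ∀ c : ℝ, 0 ≤ c → c ≤ 50000 →
      B * (B * E) * (c * γ * L * t) ≤ 100000 * B ^ 2 * (γ * E * G) * L * t := by
    intro t ht c hc hc'
    have e1 : B * (B * E) * (c * γ * L * t) = (B ^ 2 * E * γ * L * t) * c := by ring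
    have e2 : 100000 * B ^ 2 * (γ * E * G) * L * t = (B ^ 2 * E * γ * L * t) * (100000 * G) := by
      ring
    rw [e1, e2]
    gcongr
    linarith
  have hBB : ∀ t : ℝ, 0 ≤ t → B * E * t ≤ B * (B * E) * t := fun t ht => by
    have : 1 * (B * E * t) ≤ B * (B * E * t) := by gcongr
    linarith
  -- Here both points lie within `5 * dist x y` of one `ι a`. The quasi-triangle inequality through
  -- `f a` is the source of the second factor `B`.
  have hfar : ∀ x y, 0 < r x → 0 < r y → r x / 2 ≤ dist x y →
      ν.toFun (S x - S y) ≤ 100000 * B ^ 2 * (γ * E * G) * L * dist x y := by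
    intro x y hx hy hxy
    obtain ⟨a, ha⟩ := hclose x hx
    have h1 := hpoint x hx a
    have h2 := hpoint y hy a
    have hya : dist y (ι a) ≤ 5 * dist x y := by
      linarith [dist_triangle_left y (ι a) x]
    have hxa : dist x (ι a) ≤ 5 * dist x y := by
      linarith [(dist_nonneg : 0 ≤ dist x y)]
    have e : S x - S y = (S x - f a) + (f a - S y) := by abel
    have h3 := ν.map_add_le hp hp1 (S x - f a) (f a - S y)
    rw [ν.map_sub_comm (f a)] at h3
    have h4 : max (ν.toFun (S x - f a)) (ν.toFun (S y - f a)) ≤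
        B * E * (25 * γ * L * (5 * dist x y)) :=
      max_le (h1.trans (by gcongr)) (h2.trans (by gcongr))
    have h5 : (2 : ℝ) ^ (1 / p - 1) ≤ B := Real.rpow_le_rpow (by norm_num) (by norm_num) hexp
    rw [e]
    calc _ ≤ _ := h3
      _ ≤ B * (2 * (B * E * (25 * γ * L * (5 * dist x y)))) := by
        have := (ν.nonneg (S x - f a)).trans (le_max_left _ (ν.toFun (S y - f a)))
        gcongr
      _ = B * (B * E) * (250 * γ * L * dist x y) := by ring
      _ ≤ _ := hcst _ dist_nonneg _ (by norm_num) (by norm_num)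
  have hnear : ∀ x y, 0 < r x → 0 < r y → dist x y < r x / 2 →
      ν.toFun (S x - S y) ≤ 100000 * B ^ 2 * (γ * E * G) * L * dist x y := by
    intro x y hx hy hxy
    obtain ⟨a, ha⟩ := hclose x hx
    have hrxy : |r x - r y| ≤ dist x y := by
      have := (Metric.lipschitz_infDist_pt (Set.range ι)).dist_le_mul x y
      rwa [NNReal.coe_one, one_mul, Real.dist_eq] at this
    obtain ⟨hr1, hr2⟩ := abs_le.1 hrxy
    set T' := T x ∪ T y
    have hcT : T'.card ≤ 4 * (d + 1) :=
      (Finset.card_union_le _ _).trans (by linarith [hcard x, hcard y])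
    have hext : ∀ x', T x' ⊆ T' → 0 < r x' →
        S x' - f a = ∑ i ∈ T', φ x' i • (f (z i) - f a) := by
      intro x' hsub hx'
      rw [← Finset.sum_subset hsub fun i _ hi => by rw [hφzero x' i hi, zero_smul]]
      simp only [smul_sub, Finset.sum_sub_distrib, ← Finset.sum_smul, hφ1 x' hx', one_smul, hS]
    have hsx : T x ⊆ T' := Finset.subset_union_left
    have hsy : T y ⊆ T' := Finset.subset_union_right
    -- Both weight families sum to `1`, so subtracting `f a` from every value changes nothing.
    have e : S x - S y = ∑ i ∈ T', (φ x i - φ y i) • (f (z i) - f a) := by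
      rw [← sub_sub_sub_cancel_right (S x) (S y) (f a), hext x hsx hx, hext y hsy hy,
        ← Finset.sum_sub_distrib]
      simp only [sub_smul]
    -- Indices active at `y` are the worst: `r y ≤ 3/2 * r x` gives `36 + 1/2 + 2 ≤ 39`.
    have hW : ∀ i ∈ T', ν.toFun (f (z i) - f a) ≤ L * (39 * γ * r x) := by
      intro i hi
      refine (hf _ _).trans (mul_le_mul_of_nonneg_left ?_ hL)
      have hγr : 1 * r x ≤ γ * r x := by gcongr
      rcases Finset.mem_union.1 hi with hi | hi
      · linarith [hza x a i hi]
      · have h1 := hza y a i hi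
        have h2 := dist_triangle_left y (ι a) x
        have h3 : 24 * γ * r y ≤ 24 * γ * (3 / 2 * r x) := by gcongr; linarith
        linarith
    have hsum : ∀ x', T x' ⊆ T' →
        ∑ j ∈ T x', h j x' ^ (Q + 1) = ∑ j ∈ T', h j x' ^ (Q + 1) := fun x' hsub =>
      Finset.sum_subset hsub fun i _ hi => by rw [hzero x' i hi]; simp
    -- `r y ≥ r x / 2`, so both points have a bump of height at least `r x / 16`.
    have hφd : ∑ i ∈ T', |φ x i - φ y i| ≤ 12 * (Q + 1) * dist x y / (r x / 16) := by
      simp only [hφ]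
      rw [hsum x hsx, hsum y hsy]
      refine sum_abs_normalized_pow_sub_le T' (hcT.trans hQ) (fun i => h0 i x) (fun i => h0 i y)
        (by positivity) ?_ ?_ fun i => hlip i x y
      · obtain ⟨j, hj⟩ := hbig x hx
        change r x / 8 ≤ _ at hj
        exact ⟨j, hsx ((hT x j).2 (by linarith)), by linarith⟩
      · obtain ⟨j, hj⟩ := hbig y hy
        change r y / 8 ≤ _ at hj
        exact ⟨j, hsy ((hT y j).2 (by linarith)), by linarith⟩
    have hmain := ν.map_sum_smul_le hp hp1 T' (fun i => φ x i - φ y i) (fun i => f (z i) - f a)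
      (by positivity) fun i hi _ => hW i hi
    have hc : (T'.card : ℝ) ^ (1 / p - 1) ≤ B * E := by
      rw [← hBE]
      exact Real.rpow_le_rpow (Nat.cast_nonneg _) (by exact_mod_cast hcT) hexp
    rw [e]
    have hd : 0 ≤ dist x y := dist_nonneg
    calc _ ≤ _ := hmain
      _ ≤ B * E * (12 * (Q + 1) * dist x y / (r x / 16)) * (L * (39 * γ * r x)) := by
        have : 0 ≤ ∑ i ∈ T', |φ x i - φ y i| := Finset.sum_nonneg fun _ _ => abs_nonneg _
        gcongr
      _ = B * E * (7488 * γ * L * dist x y * (Q + 1)) := by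
        field_simp; ring
      _ ≤ B * (B * E) * (7488 * γ * L * dist x y * (Q + 1)) := hBB _ (by positivity)
      _ ≤ B * (B * E) * (7488 * γ * L * dist x y * (10 * G)) := by gcongr
      _ = 74880 * (B ^ 2 * (γ * E * G) * L * dist x y) := by ring
      _ ≤ 100000 * (B ^ 2 * (γ * E * G) * L * dist x y) := by gcongr; norm_num
      _ = _ := by ring
  -- At closure points outside the range the value of `S` is irrelevant; they are excluded from the
  -- estimate and reassigned later by density.
  set F : M → Z := fun x => if hx : ∃ a, ι a = x then f hx.choose else S x with hF
  have hFι : ∀ a, F (ι a) = f a := fun a => by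
    have hx : ∃ b, ι b = ι a := ⟨a, rfl⟩
    simp only [hF, dif_pos hx, hι.injective hx.choose_spec]
  have hFS : ∀ x, 0 < r x → F x = S x := fun x hx => by
    have : ¬ ∃ a, ι a = x := by
      rintro ⟨a, rfl⟩
      have := hr_le (ι a) a
      rw [dist_self] at this
      linarith
    simp only [hF, dif_neg this]
  have hNS : ∀ a y, 0 < r y →
      ν.toFun (S y - f a) ≤ 100000 * B ^ 2 * (γ * E * G) * L * dist y (ι a) := fun a y hy =>
    (hpoint y hy a).trans <| (hBB _ (by positivity)).trans <|
      hcst _ dist_nonneg _ (by norm_num) (by norm_num)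
  refine ⟨F, hFι, ?_⟩
  rintro x (⟨a, rfl⟩ | hx) y (⟨b, rfl⟩ | hy)
  · rw [hFι, hFι, hι.dist_eq]
    refine (hf a b).trans ?_
    have h1 : 1 ≤ 100000 * B ^ 2 * (γ * E * G) := by
      have h2 : 1 ≤ B ^ 2 := one_le_pow₀ hB
      have h3 : 1 * 1 ≤ γ * E := by gcongr
      have h4 : 1 * 1 * (1 / 2) ≤ γ * E * G := by gcongr
      have h5 : 1 * (1 * 1 * (1 / 2)) ≤ B ^ 2 * (γ * E * G) := by gcongr
      linarith
    have := mul_le_mul_of_nonneg_right h1 (mul_nonneg hL (dist_nonneg (x := a) (y := b)))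
    linarith
  · rw [hFι, hFS y hy, ν.map_sub_comm, dist_comm]
    exact hNS a y hy
  · rw [hFι, hFS x hx]
    exact hNS b x hx
  · rw [hFS x hx, hFS y hy]
    rcases le_or_gt (r x / 2) (dist x y) with h | h
    · exact hfar x y hx hy h
    · exact hnear x y hx hy h

/-! ### Extension to all of `M` and the extendability bound. -/

theorem theorem3p2 (p : ℝ) (hp0 : 0 < p) (hp1 : p ≤ 1) :
    ∃ K : ℝ, 0 < K ∧
      ∀ (N : Type u) [MetricSpace N] (d : ℕ) (γ : ℝ), 1 ≤ γ → HasNagataDimLE N d γ →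
        absExtendability.{u, v, w} p N ≤
          ENNReal.ofReal (K * (γ * ((d : ℝ) + 1) ^ (1 / p - 1) * Real.log ((d : ℝ) + 2))) ∧
        ∀ (M : Type v) [MetricSpace M] (ι : N → M), Isometry ι →
          ∀ (Z : Type w) [AddCommGroup Z] [Module ℝ Z] (ν : PNorm p Z), ν.IsBanach →
            ∀ f : N → Z, ν.lip f < ∞ →
              ∃ F : M → Z, (∀ x, F (ι x) = f x) ∧
                ν.lip F ≤
                  ENNReal.ofReal
                      (K * (γ * ((d : ℝ) + 1) ^ (1 / p - 1) * Real.log ((d : ℝ) + 2))) *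
                    ν.lip f := by
  refine ⟨100000 * (4 ^ (1 / p - 1)) ^ 2, by positivity, fun N _ d γ hγ hN => ?_⟩
  set C : ℝ := 100000 * (4 ^ (1 / p - 1)) ^ 2 *
    (γ * ((d : ℝ) + 1) ^ (1 / p - 1) * Real.log ((d : ℝ) + 2)) with hC
  have hCpos : 0 < C := by
    have : 0 < Real.log ((d : ℝ) + 2) :=
      Real.log_pos (by linarith [(Nat.cast_nonneg d : (0 : ℝ) ≤ d)])
    positivity
  have ext : ∀ (M : Type v) [MetricSpace M] (ι : N → M), Isometry ι →
      ∀ (Z : Type w) [AddCommGroup Z] [Module ℝ Z] (ν : PNorm p Z), ν.IsBanach →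
        ∀ f : N → Z, ν.lip f < ∞ →
          ∃ F : M → Z, (∀ x, F (ι x) = f x) ∧ ν.lip F ≤ ENNReal.ofReal C * ν.lip f := by
    intro M _ ι hι Z _ _ ν hν f hf
    rcases isEmpty_or_nonempty N with hempty | hnonempty
    -- With `N` empty there are no base points `z i`, and the zero map serves.
    · refine ⟨fun _ => 0, fun x => hempty.elim x, ?_⟩
      refine (ν.lip_le_of_map_sub_le (L := 0) fun x y => ?_).trans (by simp)
      simp [ν.map_zero]
    · have hL : 0 ≤ (ν.lip f).toReal := ENNReal.toReal_nonneg
      obtain ⟨F₀, hF₀, hlip⟩ :=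
        hN.exists_lipschitz_off_closure hp0 hp1 hγ hι ν hL (ν.map_sub_le_lip hf)
      have hD : Dense (Set.range ι ∪ {x | 0 < Metric.infDist x (Set.range ι)}) := by
        intro x
        rcases (Metric.infDist_nonneg (x := x) (s := Set.range ι)).eq_or_lt with h | h
        · exact closure_mono Set.subset_union_left
            ((Metric.mem_closure_iff_infDist_zero (Set.range_nonempty ι)).2 h.symm)
        · exact subset_closure (Or.inr h)
      obtain ⟨F, hF, hFlip⟩ :=
        ν.exists_extension_of_dense hν hD (mul_nonneg hCpos.le hL) hlip
      refine ⟨F, fun x => (hF _ (Or.inl ⟨x, rfl⟩)).trans (hF₀ x), ?_⟩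
      refine (ν.lip_le_of_map_sub_le hFlip).trans ?_
      rw [ENNReal.ofReal_mul hCpos.le, ENNReal.ofReal_toReal hf.ne]
  refine ⟨?_, ext⟩
  refine iSup_le fun M => iSup_le fun _ => iSup_le fun ι => iSup_le fun hι => sInf_le ?_
  refine ⟨ENNReal.ofReal_pos.2 hCpos, fun Z _ _ ν hν f hf => ?_⟩
  obtain ⟨F, hF, hlip⟩ := ext M ι hι Z ν hν f hf
  exact ⟨F, hF, hlip.trans_lt (ENNReal.mul_lt_top ENNReal.ofReal_lt_top hf), hlip⟩
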